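/- Consider a finite stochastic partial monitoring game with $N$ actions, $M$ outcomes and $A$ symbols, given by a loss matrix $L\in\mathbb{R}^{N\times M}$ with rows $L_i^\top$ and a feedback matrix $H=(h_{i,j})\in[A]^{N\times M}$. Let $\mathcal{P}_M$ be the set of probability vectors on $[M]$. Against an opponent's strategy $p\in\mathcal{P}_M$, in each round $t=1,2,\dots$ a (possibly randomized) algorithm selects an action $i(t)$ on the basis of its past actions and past signals only, an outcome $j(t)\sim p$ is drawn independently of $i(t)$ and of the past, and the algorithm observes only the signal $h_{i(t),j(t)}$. Let $N_i(T)$ be the number of rounds before the $T$-th in which action $i$ is selected, let $\mathrm{Regret}(T)=\sum_{t=1}^{T}\bigl(L_{i(t)}^\top p-\min_k L_k^\top p\bigr)$, and let $S_i\in\{0,1\}^{A\times M}$ be the signal matrix of action $i$, with $(k,j)$ entry $1$ if $h_{i,j}=k$ and $0$ otherwise. For probability vectors $u,v$ on $[A]$ put $D(u\|v)=\sum_k u_k\log(u_k/v_k)\in[0,\infty]$, where terms with $u_k=0$ are $0$ and terms with $u_k>0=v_k$ are $+\infty$. The algorithm is called strongly consistent (for $L$ and $H$) if $\mathbb{E}_p[\mathrm{Regret}(T)]=o(T^a)$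 as $T\to\infty$ for every $a>0$ and every $p\in\mathcal{P}_M$. Suppose that the algorithm is strongly consistent, and that action $1$ is the unique optimal action under $p^*\in\mathcal{P}_M$, i.e. $L_1^\top p^*<L_k^\top p^*$ for all $k\ne1$. Let $\mathcal{C}_1=\{q\in\mathcal{P}_M:\ (L_1-L_k)^\top q\le 0\ \text{for all }k\neq 1\}$ be the optimality cell of action $1$. Then for every $q\in\mathcal{P}_M\setminus\mathcal{C}_1$ and all sufficiently large $T$, $$\sum_{i=1}^{N}\mathbb{E}_{p^*}[N_i(T)]\,D(S_ip^*\,\|\,S_iq)\ \ge\ \log T-o(\log T),$$ where $0\cdot\infty=0$ and the $o(\log T)$ term (as $T\to\infty$) may depend on $q$, as well as on $L$, $H$, $p^*$ and the algorithm. -/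

import Mathlib

open scoped ENNReal Matrix
open Filter Asymptotics

noncomputable section

namespace PartialMonitoring

variable {N M A : ℕ}

/-- The probability vector in `ℝ^M` of an opponent's strategy. -/
def probVec (p : PMF (Fin M)) : Fin M → ℝ := fun j => (p j).toReal

/-- The expected loss `L_iᵀ p` of action `i` when outcomes are drawn from `p`. -/
def expLoss (L : Matrix (Fin N) (Fin M) ℝ) (p : PMF (Fin M)) (i : Fin N) : ℝ :=
  L i ⬝ᵥ probVec p

/-- Action `i` is the unique minimizer of the expected loss under `p`. -/
def IsUniqueOptimal (L : Matrix (Fin N) (Fin M) ℝ) (p : PMF (Fin M)) (i : Fin N) : Prop :=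
  ∀ k, k ≠ i → expLoss L p i < expLoss L p k

/-- The optimality cell of action `i`: the strategies under which `i` is optimal. -/
def cell (L : Matrix (Fin N) (Fin M) ℝ) (i : Fin N) : Set (PMF (Fin M)) :=
  {q | ∀ k, k ≠ i → (L i - L k) ⬝ᵥ probVec q ≤ 0}

/-- The signal matrix of action `i`: the entry at `(k, j)` is `1` if `h_{i,j} = k`, else `0`. -/
def signalMatrix (H : Matrix (Fin N) (Fin M) (Fin A)) (i : Fin N) :
    Matrix (Fin A) (Fin M) ℝ :=
  Matrix.of fun k j => if H i j = k then 1 else 0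

/-- The vector `S_i p`: the distribution of the symbol observed on selecting `i`. -/
def signalDist (H : Matrix (Fin N) (Fin M) (Fin A)) (i : Fin N) (p : PMF (Fin M)) :
    Fin A → ℝ :=
  signalMatrix H i *ᵥ probVec p

open Classical in
/-- The Kullback-Leibler divergence `∑ k, u k * log (u k / v k)` of two probability vectors,
where terms with `u k = 0` vanish and a term with `u k ≠ 0`, `v k = 0` is infinite. -/
def divergence (u v : Fin A → ℝ) : ℝ≥0∞ :=
  if ∃ k, u k ≠ 0 ∧ v k = 0 then ⊤
  else ENNReal.ofReal (∑ k, u k * Real.log (u k / v k))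

/-- A (possibly randomized) algorithm: given the actions and signals of the `t` rounds played
so far, the distribution of the next action. -/
def Algorithm (N A : ℕ) : Type :=
  (t : ℕ) → (Fin t → Fin N × Fin A) → PMF (Fin N)

/-- What the learner has observed: the actions and the signals, not the outcomes. -/
def observed (H : Matrix (Fin N) (Fin M) (Fin A)) {t : ℕ} (ω : Fin t → Fin N × Fin M) :
    Fin t → Fin N × Fin A :=
  fun s => ((ω s).1, H (ω s).1 (ω s).2)

/-- The joint law of the actions and outcomes of the first `t` rounds. In each round the
action is drawn by the algorithm from the observed past, and the outcome is drawn from `p`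
independently of the past and of the action. -/
def play (H : Matrix (Fin N) (Fin M) (Fin A)) (alg : Algorithm N A) (p : PMF (Fin M)) :
    (t : ℕ) → PMF (Fin t → Fin N × Fin M)
  | 0 => PMF.pure Fin.elim0
  | t + 1 =>
    (play H alg p t).bind fun ω =>
      (alg t (observed H ω)).bind fun i =>
        p.bind fun j => PMF.pure (Fin.snoc (α := fun _ => Fin N × Fin M) ω (i, j))

/-- The number of rounds of a finite play in which action `i` is selected. -/
def count (i : Fin N) {t : ℕ} (ω : Fin t → Fin N × Fin M) : ℕ :=
  (Finset.univ.filter fun s => (ω s).1 = i).card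

/-- `E[N_i(T)]`, where `N_i(T)` counts the selections of `i` in the rounds `1, …, T - 1`,
that is, before the `T`-th round. -/
def expDraws (H : Matrix (Fin N) (Fin M) (Fin A)) (alg : Algorithm N A) (p : PMF (Fin M))
    (i : Fin N) (T : ℕ) : ℝ≥0∞ :=
  ∑ ω : Fin (T - 1) → Fin N × Fin M, play H alg p (T - 1) ω * (count i ω : ℝ≥0∞)

/-- The gap of action `i` under `p`: its excess expected loss over an optimal action. -/
def gap (L : Matrix (Fin N) (Fin M) ℝ) (p : PMF (Fin M)) (i : Fin N) : ℝ :=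
  expLoss L p i - ⨅ k, expLoss L p k

/-- `E[Regret(T)]`, the expected sum of the gaps of the actions of the rounds `1, …, T`. -/
def expRegret (L : Matrix (Fin N) (Fin M) ℝ) (H : Matrix (Fin N) (Fin M) (Fin A))
    (alg : Algorithm N A) (p : PMF (Fin M)) (T : ℕ) : ℝ :=
  ∑ ω : Fin T → Fin N × Fin M, (play H alg p T ω).toReal * ∑ s, gap L p (ω s).1

/-- Strong consistency for `L` and `H`: under every strategy of the opponent the expected
regret grows more slowly than every positive power of the horizon. -/
def StronglyConsistent (L : Matrix (Fin N) (Fin M) ℝ) (H : Matrix (Fin N) (Fin M) (Fin A))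
    (alg : Algorithm N A) : Prop :=
  ∀ p : PMF (Fin M), ∀ a : ℝ, 0 < a →
    (fun T : ℕ => expRegret L H alg p T) =o[atTop] fun T : ℕ => (T : ℝ) ^ a

end PartialMonitoring

end

/-!
The bound comes from a change of measure from `p` to `q`. Fix a horizon `t = T - 1` and a function
`ψ` of the observed play with values in `[0, B]`. The Donsker-Varadhan inequality, chained over the
rounds, gives
`E_p[ψ] ≤ ∑ i, E_p[N_i] * min (D (S_i p ‖ S_i q)) B + log E_q[exp ψ]` (`expect_play_le`).
In each round the outcome contributes the divergence of the signals of the selected action, while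
the randomization of the algorithm is common to both laws and is absorbed by Jensen's inequality.
Capping the divergence at `B` is harmless for such `ψ`, and lets infinite divergences, the
convention `0 * ∞ = 0` and the finite case be treated at once.

Take `ψ = c * N_{i₁} / t` with `c = (1 - a) log t` and `0 < a < 1`. Since `exp (c x) ≤ 1 + exp c * x`
on `[0, 1]`, the last expectation is at most `1 + t ^ (-a) * E_q[N_{i₁}]`. Outside the cell of `i₁`,
action `i₁` has a positive gap under `q`, so that consistency at `q` gives
`E_q[N_{i₁}] = o(t ^ a)` and the logarithm is at most `log 2`. All other actions have a
positive gap under `p`, so that consistency at `p` gives `E_p[N_{i₁}] ≥ (1 - a) t`. Hence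
`(1 - a)² log t - log 2` is a lower bound of the sum (`eventually_log_le`) for every `a`, which is
the claim.
-/

namespace PartialMonitoring

variable {N M A : ℕ}

/-! ### Expectations under a probability mass function on a finite type -/

/-- The expectation of `F` under a probability mass function `μ` on a finite type, as a finite
sum of real numbers. -/
noncomputable def expect {α : Type*} [Fintype α] (μ : PMF α) (F : α → ℝ) : ℝ :=
  ∑ x, (μ x).toReal * F x

section expect

variable {α β : Type*} [Fintype α] [Fintype β]

lemma sum_toReal (μ : PMF α) : ∑ x, (μ x).toReal = 1 := by
  rw [← ENNReal.toReal_sum fun x _ => μ.apply_ne_top x, ← tsum_fintype (L := .unconditional α),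
    μ.tsum_coe, ENNReal.toReal_one]

lemma expect_pure (a : α) (F : α → ℝ) : expect (PMF.pure a) F = F a := by
  classical
  rw [expect, Finset.sum_eq_single a]
  · simp
  · intro b _ hb
    simp [PMF.pure_apply, hb]
  · simp

lemma expect_bind (μ : PMF α) (f : α → PMF β) (F : β → ℝ) :
    expect (μ.bind f) F = expect μ fun x => expect (f x) F := by
  have key : ∀ y, ((μ.bind f) y).toReal = ∑ x, (μ x).toReal * (f x y).toReal := by
    intro y
    rw [PMF.bind_apply, tsum_fintype, ENNReal.toReal_sum]
    · simp only [ENNReal.toReal_mul]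
    · intro x _
      exact ENNReal.mul_ne_top (μ.apply_ne_top x) ((f x).apply_ne_top y)
  simp only [expect, key, Finset.sum_mul, Finset.mul_sum]
  rw [Finset.sum_comm]
  simp only [mul_assoc]

lemma expect_mono (μ : PMF α) {F G : α → ℝ} (h : ∀ x, F x ≤ G x) : expect μ F ≤ expect μ G :=
  Finset.sum_le_sum fun x _ => mul_le_mul_of_nonneg_left (h x) ENNReal.toReal_nonneg

lemma expect_add (μ : PMF α) (F G : α → ℝ) :
    expect μ (fun x => F x + G x) = expect μ F + expect μ G := by
  simp only [expect, mul_add, Finset.sum_add_distrib]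

lemma expect_const_mul (μ : PMF α) (c : ℝ) (F : α → ℝ) :
    expect μ (fun x => c * F x) = c * expect μ F := by
  simp only [expect, Finset.mul_sum]
  exact Finset.sum_congr rfl fun x _ => by ring

lemma expect_const (μ : PMF α) (c : ℝ) : expect μ (fun _ => c) = c := by
  rw [expect, ← Finset.sum_mul, sum_toReal, one_mul]

/-- Jensen's inequality for the logarithm. -/
lemma expect_log_le (μ : PMF α) {F : α → ℝ} (h : ∀ x, 0 < F x) :
    expect μ (fun x => Real.log (F x)) ≤ Real.log (expect μ F) :=
  strictConcaveOn_log_Ioi.concaveOn.le_map_sum (fun _ _ => ENNReal.toReal_nonneg)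
    (sum_toReal μ) fun x _ => h x

end expect

/-! ### The distribution of the signals -/

lemma signalDist_apply (H : Matrix (Fin N) (Fin M) (Fin A)) (i : Fin N) (p : PMF (Fin M))
    (k : Fin A) : signalDist H i p k = ∑ j, if H i j = k then (p j).toReal else 0 := by
  simp [signalDist, signalMatrix, Matrix.mulVec, dotProduct, probVec]

lemma signalDist_nonneg (H : Matrix (Fin N) (Fin M) (Fin A)) (i : Fin N) (p : PMF (Fin M))
    (k : Fin A) : 0 ≤ signalDist H i p k := by
  rw [signalDist_apply]
  exact Finset.sum_nonneg fun j _ => by split_ifs <;> simp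

lemma expect_signal (H : Matrix (Fin N) (Fin M) (Fin A)) (i : Fin N) (p : PMF (Fin M))
    (g : Fin A → ℝ) : expect p (fun j => g (H i j)) = ∑ k, signalDist H i p k * g k := by
  simp only [signalDist_apply, Finset.sum_mul, expect]
  rw [Finset.sum_comm]
  refine Finset.sum_congr rfl fun j _ => ?_
  simp [ite_mul]

lemma sum_signalDist (H : Matrix (Fin N) (Fin M) (Fin A)) (i : Fin N) (p : PMF (Fin M)) :
    ∑ k, signalDist H i p k = 1 := by
  simpa [expect_const] using (expect_signal H i p fun _ => 1).symm

/-! ### The Donsker-Varadhan inequality -/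

/-- The Donsker-Varadhan inequality on a finite alphabet. -/
lemma sum_mul_le_add_log {u v ψ : Fin A → ℝ} (hu : ∀ k, 0 ≤ u k) (hv : ∀ k, 0 ≤ v k)
    (hu1 : ∑ k, u k = 1) (hZ : 0 < ∑ k, v k * Real.exp (ψ k))
    (huv : ∀ k, v k = 0 → u k = 0) :
    ∑ k, u k * ψ k ≤
      ∑ k, u k * Real.log (u k / v k) + Real.log (∑ k, v k * Real.exp (ψ k)) := by
  set Z := ∑ k, v k * Real.exp (ψ k) with hZdef
  have hterm : ∀ k, u k * ψ k - u k * Real.log (u k / v k) - u k * Real.log Z ≤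
      v k * Real.exp (ψ k) / Z - u k := by
    intro k
    rcases (hu k).eq_or_lt with h0 | hpos
    · rw [← h0]
      have := hv k
      have : 0 ≤ v k * Real.exp (ψ k) / Z := by positivity
      linarith
    · have hvk : 0 < v k := (hv k).lt_of_ne fun h => hpos.ne' (huv k h.symm)
      have hlog := Real.log_le_sub_one_of_pos
        (show 0 < v k * Real.exp (ψ k) / (u k * Z) by positivity)
      rw [Real.log_div (by positivity) (by positivity), Real.log_mul hvk.ne' (by positivity),
        Real.log_exp, Real.log_mul hpos.ne' hZ.ne'] at hlog
      rw [Real.log_div hpos.ne' hvk.ne']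
      have h := mul_le_mul_of_nonneg_left hlog hpos.le
      have e : u k * (v k * Real.exp (ψ k) / (u k * Z) - 1) =
          v k * Real.exp (ψ k) / Z - u k := by
        field_simp
      rw [e] at h
      linarith
  have hsum := Finset.sum_le_sum fun k (_ : k ∈ Finset.univ) => hterm k
  simp only [Finset.sum_sub_distrib] at hsum
  rw [← Finset.sum_div, ← Finset.sum_mul, ← hZdef, div_self hZ.ne', hu1] at hsum
  linarith

/-- The divergence of the signals of action `i`, capped at `B`. -/
noncomputable def cappedDivergence (H : Matrix (Fin N) (Fin M) (Fin A)) (p q : PMF (Fin M)) (B : ℝ)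
    (i : Fin N) : ℝ :=
  (min (divergence (signalDist H i p) (signalDist H i q)) (ENNReal.ofReal B)).toReal

/-- For test functions with values in `[0, B]` the divergence in the Donsker-Varadhan inequality
may be capped at `B`, which covers an infinite divergence as well. -/
lemma expect_signal_le (H : Matrix (Fin N) (Fin M) (Fin A)) (p q : PMF (Fin M)) (i : Fin N)
    {B : ℝ} {ψ : Fin A → ℝ} (h0 : ∀ k, 0 ≤ ψ k) (hB : ∀ k, ψ k ≤ B) :
    expect p (fun j => ψ (H i j)) ≤
      cappedDivergence H p q B i + Real.log (expect q fun j => Real.exp (ψ (H i j))) := by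
  have hZ1 : 1 ≤ expect q fun j => Real.exp (ψ (H i j)) := by
    rw [← expect_const q 1]
    exact expect_mono q fun j => Real.one_le_exp (h0 _)
  have hψB : expect p (fun j => ψ (H i j)) ≤ B := by
    rw [← expect_const p B]
    exact expect_mono p fun j => hB _
  have hψ0 : 0 ≤ expect p (fun j => ψ (H i j)) := by
    rw [← expect_const p 0]
    exact expect_mono p fun j => h0 _
  rcases le_total (ENNReal.ofReal B) (divergence (signalDist H i p) (signalDist H i q))
    with hle | hle
  · rw [cappedDivergence, min_eq_right hle, ENNReal.toReal_ofReal (hψ0.trans hψB)]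
    linarith [Real.log_nonneg hZ1]
  · rw [cappedDivergence, min_eq_left hle]
    have hfin : divergence (signalDist H i p) (signalDist H i q) ≠ ⊤ :=
      ne_top_of_le_ne_top ENNReal.ofReal_ne_top hle
    unfold divergence at hfin ⊢
    split_ifs at hfin ⊢ with hex
    · exact absurd rfl hfin
    · have hac : ∀ k, signalDist H i q k = 0 → signalDist H i p k = 0 := fun k hk => by
        by_contra hne
        exact hex ⟨k, hne, hk⟩
      have hexp := expect_signal H i q fun k => Real.exp (ψ k)
      rw [hexp] at hZ1 ⊢
      rw [expect_signal H i p ψ]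
      have hDV := sum_mul_le_add_log (signalDist_nonneg H i p) (signalDist_nonneg H i q)
        (sum_signalDist H i p) (zero_lt_one.trans_le hZ1) hac
      rw [ENNReal.toReal_ofReal']
      linarith [le_max_left (∑ k, signalDist H i p k *
        Real.log (signalDist H i p k / signalDist H i q k)) 0]

/-! ### The change of measure over a whole play -/

lemma expect_play_succ (H : Matrix (Fin N) (Fin M) (Fin A)) (alg : Algorithm N A)
    (p : PMF (Fin M)) (t : ℕ) (F : (Fin (t + 1) → Fin N × Fin M) → ℝ) :
    expect (play H alg p (t + 1)) F = expect (play H alg p t) fun ω =>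
      expect (alg t (observed H ω)) fun i => expect p fun j =>
        F (Fin.snoc (α := fun _ => Fin N × Fin M) ω (i, j)) := by
  simp only [play, expect_bind, expect_pure]

lemma observed_snoc (H : Matrix (Fin N) (Fin M) (Fin A)) {t : ℕ} (ω : Fin t → Fin N × Fin M)
    (i : Fin N) (j : Fin M) :
    observed H (Fin.snoc (α := fun _ => Fin N × Fin M) ω (i, j)) =
      Fin.snoc (α := fun _ => Fin N × Fin A) (observed H ω) (i, H i j) := by
  funext s
  refine Fin.lastCases ?_ (fun s => ?_) s <;> simp [observed]

/-- The Donsker-Varadhan inequality for the laws of the observed play under `p` and `q`, with the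
chain rule built in: the divergence of the two laws is at most the expected sum of the divergences
of the signals of the selected actions. -/
lemma expect_play_le (H : Matrix (Fin N) (Fin M) (Fin A)) (alg : Algorithm N A)
    (p q : PMF (Fin M)) {B : ℝ} (t : ℕ) (ψ : (Fin t → Fin N × Fin A) → ℝ)
    (h0 : ∀ x, 0 ≤ ψ x) (hB : ∀ x, ψ x ≤ B) :
    expect (play H alg p t) (fun ω => ψ (observed H ω)) ≤
      expect (play H alg p t) (fun ω => ∑ s, cappedDivergence H p q B (ω s).1) +
        Real.log (expect (play H alg q t) fun ω => Real.exp (ψ (observed H ω))) := by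
  induction t with
  | zero => simp [play, expect_pure]
  | succ t ih =>
    -- The inequality of the last round turns `ψ` into the test function `log ∘ Φ` of the first
    -- `t` rounds, where `Φ` is the conditional expectation of `exp ψ` under `q`.
    set Φ : (Fin t → Fin N × Fin A) → ℝ := fun x => expect (alg t x) fun i => expect q fun j =>
      Real.exp (ψ (Fin.snoc (α := fun _ => Fin N × Fin A) x (i, H i j)))
    have hlow : ∀ x i, 1 ≤ expect q fun j =>
        Real.exp (ψ (Fin.snoc (α := fun _ => Fin N × Fin A) x (i, H i j))) := fun x i => by
      rw [← expect_const q 1]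
      exact expect_mono q fun j => Real.one_le_exp (h0 _)
    have hΦ1 : ∀ x, 1 ≤ Φ x := fun x => by
      rw [← expect_const (alg t x) 1]
      exact expect_mono _ fun i => hlow x i
    have hΦB : ∀ x, Φ x ≤ Real.exp B := fun x => by
      rw [← expect_const (alg t x) (Real.exp B)]
      refine expect_mono _ fun i => ?_
      rw [← expect_const q (Real.exp B)]
      exact expect_mono _ fun j => Real.exp_le_exp.2 (hB _)
    have hΦpos : ∀ x, 0 < Φ x := fun x => zero_lt_one.trans_le (hΦ1 x)
    have hstep : ∀ x, expect (alg t x) (fun i => expect p fun j =>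
          ψ (Fin.snoc (α := fun _ => Fin N × Fin A) x (i, H i j))) ≤
        expect (alg t x) (cappedDivergence H p q B) + Real.log (Φ x) := fun x => by
      refine (expect_mono _ fun i => expect_signal_le H p q i
        (ψ := fun k => ψ (Fin.snoc (α := fun _ => Fin N × Fin A) x (i, k)))
        (fun k => h0 _) fun k => hB _).trans ?_
      rw [expect_add]
      gcongr
      exact expect_log_le _ fun i => zero_lt_one.trans_le (hlow x i)
    have hih := ih (fun x => Real.log (Φ x)) (fun x => Real.log_nonneg (hΦ1 x))
      fun x => (Real.log_le_iff_le_exp (hΦpos x)).2 (hΦB x)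
    simp only [Real.exp_log (hΦpos _)] at hih
    simp only [expect_play_succ, observed_snoc, Fin.sum_univ_castSucc, Fin.snoc_castSucc,
      Fin.snoc_last, expect_const, expect_add]
    refine (expect_mono _ fun ω => hstep (observed H ω)).trans ?_
    rw [expect_add]
    linarith

lemma sum_eq_sum_count {t : ℕ} (ω : Fin t → Fin N × Fin M) (D : Fin N → ℝ) :
    ∑ s, D (ω s).1 = ∑ i, D i * count i ω := by
  rw [← Finset.sum_fiberwise_of_maps_to (s := Finset.univ) (t := Finset.univ)
    (g := fun s => (ω s).1) fun _ _ => Finset.mem_univ _]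
  refine Finset.sum_congr rfl fun i _ => ?_
  rw [Finset.sum_congr rfl fun s hs => by rw [(Finset.mem_filter.1 hs).2], Finset.sum_const,
    nsmul_eq_mul, mul_comm, count]

lemma expDraws_eq (H : Matrix (Fin N) (Fin M) (Fin A)) (alg : Algorithm N A) (p : PMF (Fin M))
    (i : Fin N) (T : ℕ) : expDraws H alg p i T =
      ENNReal.ofReal (expect (play H alg p (T - 1)) fun ω => (count i ω : ℝ)) := by
  rw [expDraws, expect, ENNReal.ofReal_sum_of_nonneg fun _ _ => by positivity]
  refine Finset.sum_congr rfl fun ω _ => ?_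
  rw [ENNReal.ofReal_mul ENNReal.toReal_nonneg, ENNReal.ofReal_toReal (PMF.apply_ne_top _ _),
    ENNReal.ofReal_natCast]

/-- The right-hand side of the lower bound dominates the information term of the change of
measure, at any cap `B`. -/
lemma ofReal_expect_le_sum (H : Matrix (Fin N) (Fin M) (Fin A)) (alg : Algorithm N A)
    (p q : PMF (Fin M)) (B : ℝ) (T : ℕ) :
    ENNReal.ofReal (expect (play H alg p (T - 1)) fun ω =>
        ∑ s, cappedDivergence H p q B (ω s).1) ≤
      ∑ i, expDraws H alg p i T * divergence (signalDist H i p) (signalDist H i q) := by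
  have hswap : (expect (play H alg p (T - 1)) fun ω =>
      ∑ s, cappedDivergence H p q B (ω s).1) =
      ∑ i, (expect (play H alg p (T - 1)) fun ω => (count i ω : ℝ)) *
        cappedDivergence H p q B i := by
    simp only [sum_eq_sum_count, expect, Finset.mul_sum, Finset.sum_mul]
    rw [Finset.sum_comm]
    exact Finset.sum_congr rfl fun i _ => Finset.sum_congr rfl fun ω _ => by ring
  have hcount : ∀ i, 0 ≤ expect (play H alg p (T - 1)) fun ω => (count i ω : ℝ) := fun i =>
    Finset.sum_nonneg fun ω _ => by positivity
  rw [hswap, ENNReal.ofReal_sum_of_nonneg fun i _ =>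
    mul_nonneg (hcount i) (show 0 ≤ cappedDivergence H p q B i from ENNReal.toReal_nonneg)]
  refine Finset.sum_le_sum fun i _ => ?_
  rw [ENNReal.ofReal_mul (hcount i), expDraws_eq]
  gcongr
  exact ENNReal.ofReal_toReal_le.trans (min_le_left _ _)

/-! ### What consistency says about the number of selections -/

lemma expRegret_eq (L : Matrix (Fin N) (Fin M) ℝ) (H : Matrix (Fin N) (Fin M) (Fin A))
    (alg : Algorithm N A) (p : PMF (Fin M)) (T : ℕ) :
    expRegret L H alg p T = expect (play H alg p T) fun ω => ∑ s, gap L p (ω s).1 := rfl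

lemma sub_le_gap (L : Matrix (Fin N) (Fin M) ℝ) (p : PMF (Fin M)) (i k : Fin N) :
    expLoss L p i - expLoss L p k ≤ gap L p i :=
  sub_le_sub_left (ciInf_le (Set.finite_range _).bddBelow k) _

lemma gap_nonneg (L : Matrix (Fin N) (Fin M) ℝ) (p : PMF (Fin M)) (i : Fin N) :
    0 ≤ gap L p i := by
  simpa using sub_le_gap L p i i

lemma gap_pos_of_notMem_cell {L : Matrix (Fin N) (Fin M) ℝ} {q : PMF (Fin M)} {i : Fin N}
    (hq : q ∉ cell L i) : 0 < gap L q i := by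
  simp only [cell, Set.mem_ofPred_eq, not_forall, not_le] at hq
  obtain ⟨k, -, hk⟩ := hq
  rw [sub_dotProduct] at hk
  exact hk.trans_le (sub_le_gap L q i k)

lemma gap_mul_expect_count_le (L : Matrix (Fin N) (Fin M) ℝ)
    (H : Matrix (Fin N) (Fin M) (Fin A)) (alg : Algorithm N A) (q : PMF (Fin M)) (i : Fin N)
    (t : ℕ) : gap L q i * expect (play H alg q t) (fun ω => (count i ω : ℝ)) ≤
      expRegret L H alg q t := by
  rw [expRegret_eq, ← expect_const_mul]
  refine expect_mono _ fun ω => ?_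
  rw [sum_eq_sum_count]
  exact Finset.single_le_sum (f := fun i => gap L q i * (count i ω : ℝ))
    (fun k _ => mul_nonneg (gap_nonneg L q k) (Nat.cast_nonneg _)) (Finset.mem_univ i)

lemma IsUniqueOptimal.exists_gap {L : Matrix (Fin N) (Fin M) ℝ} {p : PMF (Fin M)} {i : Fin N}
    (h : IsUniqueOptimal L p i) : ∃ δ, 0 < δ ∧ ∀ k, k ≠ i → δ ≤ gap L p k := by
  have hpos : ∀ k, k ≠ i → 0 < gap L p k := fun k hk =>
    (sub_pos.2 (h k hk)).trans_le (sub_le_gap L p k i)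
  rcases (Finset.univ.erase i).eq_empty_or_nonempty with he | hne
  · refine ⟨1, one_pos, fun k hk => ?_⟩
    have : k ∈ Finset.univ.erase i := by simp [hk]
    simp [he] at this
  · obtain ⟨m, hm, hmin⟩ := Finset.exists_min_image _ (gap L p) hne
    exact ⟨gap L p m, hpos m (Finset.ne_of_mem_erase hm), fun k hk => hmin k (by simp [hk])⟩

lemma mul_sub_expect_count_le {L : Matrix (Fin N) (Fin M) ℝ}
    (H : Matrix (Fin N) (Fin M) (Fin A)) (alg : Algorithm N A) {p : PMF (Fin M)} {i : Fin N}
    {δ : ℝ} (h : ∀ k, k ≠ i → δ ≤ gap L p k) (t : ℕ) :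
    δ * (t - expect (play H alg p t) fun ω => (count i ω : ℝ)) ≤ expRegret L H alg p t := by
  have hkey : expect (play H alg p t) (fun ω => δ * (t : ℝ)) ≤
      expect (play H alg p t) fun ω => ∑ s, gap L p (ω s).1 + δ * (count i ω : ℝ) := by
    refine expect_mono _ fun ω => ?_
    have hcount : δ * (count i ω : ℝ) = ∑ s, if (ω s).1 = i then δ else 0 := by
      rw [Finset.sum_ite, Finset.sum_const, Finset.sum_const_zero, nsmul_eq_mul, add_zero,
        mul_comm, count]
    have ht : δ * (t : ℝ) = ∑ _s : Fin t, δ := by simp [mul_comm]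
    rw [hcount, ht, ← Finset.sum_add_distrib]
    refine Finset.sum_le_sum fun s _ => ?_
    split_ifs with hs
    · linarith [gap_nonneg L p (ω s).1]
    · linarith [h _ hs]
  rw [expect_const, expect_add, expect_const_mul, ← expRegret_eq] at hkey
  linarith

lemma exp_mul_le {c x : ℝ} (hx0 : 0 ≤ x) (hx1 : x ≤ 1) :
    Real.exp (c * x) ≤ 1 + Real.exp c * x := by
  have h := convexOn_exp.2 (Set.mem_univ 0) (Set.mem_univ c) (sub_nonneg.2 hx1) hx0 (by ring)
  simp only [smul_eq_mul, mul_zero, zero_add, Real.exp_zero, mul_one] at h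
  rw [mul_comm x c, mul_comm x (Real.exp c)] at h
  linarith

lemma count_le {t : ℕ} (i : Fin N) (ω : Fin t → Fin N × Fin M) : count i ω ≤ t :=
  (Finset.card_filter_le _ _).trans (by simp)

/-- The change of measure with the fraction `N_i / t` of the rounds spent on action `i`, scaled
by `c`, as test function. -/
lemma mul_expect_count_div_le (H : Matrix (Fin N) (Fin M) (Fin A)) (alg : Algorithm N A)
    (p q : PMF (Fin M)) (i : Fin N) {t : ℕ} (ht : 0 < t) {c : ℝ} (hc : 0 ≤ c) :
    c * (expect (play H alg p t) (fun ω => (count i ω : ℝ)) / t) ≤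
      expect (play H alg p t) (fun ω => ∑ s, cappedDivergence H p q c (ω s).1) +
        Real.log (1 + Real.exp c *
          (expect (play H alg q t) (fun ω => (count i ω : ℝ)) / t)) := by
  have ht' : (0 : ℝ) < t := Nat.cast_pos.2 ht
  set ψ : (Fin t → Fin N × Fin A) → ℝ := fun x =>
    c * (((Finset.univ.filter fun s => (x s).1 = i).card : ℝ) / t)
  have hψo : ∀ ω : Fin t → Fin N × Fin M, ψ (observed H ω) = c * ((count i ω : ℝ) / t) :=
    fun ω => rfl
  have hle : ∀ x : Fin t → Fin N × Fin A,
      ((Finset.univ.filter fun s => (x s).1 = i).card : ℝ) / t ≤ 1 := fun x => by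
    rw [div_le_one ht']
    exact_mod_cast (Finset.card_filter_le _ _).trans (by simp)
  have hDV := expect_play_le H alg p q (B := c) t ψ (fun x => by positivity)
    fun x => mul_le_of_le_one_right hc (hle x)
  simp only [hψo, expect_const_mul] at hDV
  simp only [div_eq_inv_mul, expect_const_mul] at hDV ⊢
  refine hDV.trans (add_le_add_right (Real.log_le_log ?_ ?_) _)
  · refine zero_lt_one.trans_le ?_
    rw [← expect_const (play H alg q t) 1]
    exact expect_mono _ fun ω => Real.one_le_exp (by positivity)
  · rw [← expect_const_mul, ← expect_const_mul]
    rw [← expect_const (play H alg q t) 1]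
    rw [← expect_add]
    refine expect_mono _ fun ω => exp_mul_le (by positivity) ?_
    rw [inv_mul_le_one₀ ht']
    exact_mod_cast count_le i ω

/-! ### The lower bound -/

/-- With `c = (1 - a) log t` in the change of measure, consistency under `q` bounds the last
logarithm by `log 2`, and consistency under `p` gives `E_p[N_{i₁}] ≥ (1 - a) t`. -/
lemma eventually_log_le {L : Matrix (Fin N) (Fin M) ℝ} {H : Matrix (Fin N) (Fin M) (Fin A)}
    {alg : Algorithm N A} (halg : StronglyConsistent L H alg) {p q : PMF (Fin M)} {i₁ : Fin N}
    (hopt : IsUniqueOptimal L p i₁) (hq : q ∉ cell L i₁) {a : ℝ} (ha : 0 < a) (ha1 : a < 1) :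
    ∀ᶠ t : ℕ in atTop, (1 - a) ^ 2 * Real.log t - Real.log 2 ≤
      expect (play H alg p t) fun ω =>
        ∑ s, cappedDivergence H p q ((1 - a) * Real.log t) (ω s).1 := by
  obtain ⟨δ, hδ, hgap⟩ := hopt.exists_gap
  have hγ := gap_pos_of_notMem_cell hq
  filter_upwards [eventually_ge_atTop 1, (halg p 1 one_pos).bound (mul_pos hδ ha),
    (halg q a ha).bound hγ] with t ht hp hq'
  have ht' : (1 : ℝ) ≤ t := Nat.one_le_cast.2 ht
  have ht0 : (0 : ℝ) < t := zero_lt_one.trans_le ht'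
  have hlog : 0 ≤ Real.log t := Real.log_nonneg ht'
  rw [Real.rpow_one, Real.norm_of_nonneg ht0.le] at hp
  rw [Real.norm_of_nonneg (Real.rpow_nonneg ht0.le a)] at hq'
  have hc : 0 ≤ (1 - a) * Real.log t := mul_nonneg (by linarith) hlog
  have hmain := mul_expect_count_div_le H alg p q i₁ ht hc
  have hP : 1 - a ≤ expect (play H alg p t) (fun ω => (count i₁ ω : ℝ)) / t := by
    have h := (mul_sub_expect_count_le H alg hgap t).trans ((le_abs_self _).trans hp)
    rw [mul_assoc, mul_le_mul_iff_right₀ hδ] at h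
    rw [le_div_iff₀ ht0]
    linarith
  have hQ : expect (play H alg q t) (fun ω => (count i₁ ω : ℝ)) ≤ (t : ℝ) ^ a :=
    le_of_mul_le_mul_left
      ((gap_mul_expect_count_le L H alg q i₁ t).trans ((le_abs_self _).trans hq')) hγ
  have hQ0 : 0 ≤ expect (play H alg q t) (fun ω => (count i₁ ω : ℝ)) :=
    Finset.sum_nonneg fun ω _ => by positivity
  have hexp : Real.exp ((1 - a) * Real.log t) *
      (expect (play H alg q t) (fun ω => (count i₁ ω : ℝ)) / t) ≤ 1 := by
    have e : Real.exp ((1 - a) * Real.log t) = (t : ℝ) / (t : ℝ) ^ a := by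
      rw [mul_comm, ← Real.rpow_def_of_pos ht0, Real.rpow_sub ht0, Real.rpow_one]
    have hta : 0 < (t : ℝ) ^ a := Real.rpow_pos_of_pos ht0 a
    rw [e, div_mul_div_comm, mul_comm, mul_div_mul_right _ _ ht0.ne']
    exact (div_le_one hta).2 hQ
  have hlog2 := Real.log_le_log (x := 1 + Real.exp ((1 - a) * Real.log t) *
    (expect (play H alg q t) (fun ω => (count i₁ ω : ℝ)) / t)) (y := 2)
    (by positivity) (by linarith)
  have hPc := mul_le_mul_of_nonneg_left hP hc
  linarith [show (1 - a) ^ 2 * Real.log t = (1 - a) * Real.log t * (1 - a) by ring]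

/-- The lower bound with a factor `1 - ε` in place of the additive error. -/
lemma eventually_ofReal_log_le {L : Matrix (Fin N) (Fin M) ℝ}
    {H : Matrix (Fin N) (Fin M) (Fin A)} {alg : Algorithm N A}
    (halg : StronglyConsistent L H alg) {p q : PMF (Fin M)} {i₁ : Fin N}
    (hopt : IsUniqueOptimal L p i₁) (hq : q ∉ cell L i₁) {ε : ℝ} (hε : 0 < ε) :
    ∀ᶠ T : ℕ in atTop, ENNReal.ofReal ((1 - ε) * Real.log T) ≤
      ∑ i, expDraws H alg p i T * divergence (signalDist H i p) (signalDist H i q) := by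
  wlog hε1 : ε < 1 generalizing ε
  · filter_upwards [eventually_ge_atTop 1] with T hT
    rw [ENNReal.ofReal_of_nonpos]
    · exact zero_le
    · exact mul_nonpos_of_nonpos_of_nonneg (by linarith)
        (Real.log_nonneg (Nat.one_le_cast.2 hT))
  have hev := (tendsto_sub_atTop_nat 1).eventually
    (eventually_log_le halg hopt hq (a := ε / 4) (by linarith) (by linarith))
  have hlarge := (Real.tendsto_log_atTop.comp tendsto_natCast_atTop_atTop).eventually_ge_atTop
    (4 * Real.log 2 / ε)
  filter_upwards [hev, hlarge, eventually_ge_atTop 2] with T hT hTlarge hT2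
  refine le_trans (ENNReal.ofReal_le_ofReal (le_trans ?_ hT))
    (ofReal_expect_le_sum H alg p q _ T)
  simp only [Function.comp_apply, div_le_iff₀ hε] at hTlarge
  have hT2' : (2 : ℝ) ≤ T := by exact_mod_cast hT2
  have hhalf : Real.log T - Real.log 2 ≤ Real.log ((T - 1 : ℕ) : ℝ) := by
    rw [← Real.log_div (by linarith) two_ne_zero, Nat.cast_sub (by omega), Nat.cast_one]
    exact Real.log_le_log (by linarith) (by linarith)
  have h2 : 0 < Real.log 2 := Real.log_pos one_lt_two
  have hfac0 : 0 ≤ (1 - ε / 4) ^ 2 := sq_nonneg _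
  have hfac1 : (1 - ε / 4) ^ 2 ≤ 1 := by nlinarith
  have hfac2 : 1 - ε / 2 ≤ (1 - ε / 4) ^ 2 := by nlinarith [sq_nonneg ε]
  have h3 := mul_le_mul_of_nonneg_left hhalf hfac0
  have h4 := mul_le_mul_of_nonneg_right hfac2 (Real.log_nonneg (one_le_two.trans hT2'))
  have h5 := mul_le_mul_of_nonneg_right hfac1 h2.le
  linarith

end PartialMonitoring

theorem lemma1 {N M A : ℕ}
    (L : Matrix (Fin N) (Fin M) ℝ) (H : Matrix (Fin N) (Fin M) (Fin A))
    (alg : PartialMonitoring.Algorithm N A)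
    (halg : PartialMonitoring.StronglyConsistent L H alg)
    (p : PMF (Fin M)) (i₁ : Fin N)
    (hopt : PartialMonitoring.IsUniqueOptimal L p i₁) :
    ∀ q : PMF (Fin M), q ∉ PartialMonitoring.cell L i₁ →
      ∃ f : ℕ → ℝ, f =o[atTop] (fun T : ℕ => Real.log (T : ℝ)) ∧
        ∀ᶠ T : ℕ in atTop,
          ENNReal.ofReal (Real.log (T : ℝ) - f T) ≤
            ∑ i : Fin N, PartialMonitoring.expDraws H alg p i T *
              PartialMonitoring.divergence (PartialMonitoring.signalDist H i p)
                (PartialMonitoring.signalDist H i q) := by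
  intro q hq
  set S : ℕ → ℝ≥0∞ := fun T => ∑ i : Fin N, PartialMonitoring.expDraws H alg p i T *
    PartialMonitoring.divergence (PartialMonitoring.signalDist H i p)
      (PartialMonitoring.signalDist H i q)
  -- The error term is the shortfall of the sum below `log T`; the minimum keeps it well-behaved
  -- when the sum is infinite.
  refine ⟨fun T => Real.log T - (min (S T) (ENNReal.ofReal (Real.log T))).toReal, ?_, ?_⟩
  · refine isLittleO_iff.2 fun ε hε => ?_
    filter_upwards [PartialMonitoring.eventually_ofReal_log_le halg hopt hq hε,
      eventually_ge_atTop 1] with T hT hT1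
    have hlog : 0 ≤ Real.log (T : ℝ) := Real.log_nonneg (Nat.one_le_cast.2 hT1)
    have hfin : min (S T) (ENNReal.ofReal (Real.log T)) ≠ ⊤ :=
      ne_top_of_le_ne_top ENNReal.ofReal_ne_top (min_le_right _ _)
    have hupper : (min (S T) (ENNReal.ofReal (Real.log T))).toReal ≤ Real.log T :=
      ENNReal.toReal_le_of_le_ofReal hlog (min_le_right _ _)
    have hlower : (1 - ε) * Real.log T ≤
        (min (S T) (ENNReal.ofReal (Real.log T))).toReal :=
      (ENNReal.ofReal_le_iff_le_toReal hfin).1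
        (le_min hT (ENNReal.ofReal_le_ofReal (by nlinarith)))
    rw [Real.norm_of_nonneg (by linarith), Real.norm_of_nonneg hlog]
    linarith
  · refine Eventually.of_forall fun T => ?_
    rw [sub_sub_cancel]
    exact ENNReal.ofReal_toReal_le.trans (min_le_left _ _)
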